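/- **Model.** An instance $I$ consists of a finite set $N$ of agents, a finite set $\mathcal V$ of plots with $|\mathcal V|=|N|$, an undirected plot graph $(\mathcal V,\mathcal E)$, plot values $u_i(v)\in[0,1]$ for $i\in N$, $v\in\mathcal V$, a symmetric friendship relation $F$ on $N$ in which every agent has at most one friend, and weights $\phi_{i,j}\ge 0$ for $(i,j)\in F$. An allocation is a bijection $A:N\to\mathcal V$; the utility of agent $i$ is $U_i(A)=u_i(A(i))+\sum_{j:(i,j)\in F}\phi_{i,j}\,\mathbb I(\{A(i),A(j)\}\in\mathcal E)$. Let $\mathrm{SW}(A)=\sum_{i}U_i(A)$ and $\mathrm{OPT}(I)=\max_A \mathrm{SW}(A)$. The instance is binary if $u_i(v)\in\{0,1\}$ for all $i,v$, and friendship-uniform with parameter $\phi>0$ if $\phi_{i,j}=\phi$ for all $(i,j)\in F$. **Mechanism FF-CT-RSD\*.** Each agent reports who her friend is (or that she has none). Let $P$ be the set of pairs who report each other. As long as $P\ne\varnothing$ and there are two adjacent unoccupied plots, a uniformly random pair is removed from $P$, and its two members, in uniformly random order, choose unoccupied plots one right after the other (not necessarily adjacent ones). Then RSD\* is run on the remaining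 agents and plots: as long as some remaining agent has a positive value for some unoccupied plot, a uniformly random such agent is picked and chooses an unoccupied plot; when there is no such agent, the remaining agents and plots are paired arbitrarily. **Behaviour.** Friendship reports are truthful, and every agent chooses a plot so as to maximize her own utility: the first mover of a pair anticipates the choice of her friend, the second mover takes into account the plot her friend has taken, and agents in the RSD\* phase take a best unoccupied plot. Ties are broken arbitrarily (possibly depending on the history). **Theorem.** Let $I$ be a binary, friendship-uniform instance with parameter $0<\phi<1$ in which every agent has at most one friend, and let $A$ be the (random) output of FF-CT-RSD\* on $I$ when all agents report their friendships truthfully. Then, for every way of breaking ties and every final pairing, $$\mathbb E\big(\mathrm{SW}(A)\big)\ \ge\ \frac{\phi}{4\phi+4}\,\mathrm{OPT}(I).$$ -/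

import Mathlib

/-- An instance of land allocation with friends: as many plots as agents, an undirected graph of
nearby plots, plot values in `[0, 1]`, a reciprocal friendship relation, and for each ordered pair
of friends `(i, j)` the nonnegative utility `weight i j` that `i` derives from living next to `j`
(weights of pairs that are not friends are never used). -/
structure LandInstance (N V : Type*) [Fintype N] [Fintype V] where
  card_eq : Fintype.card N = Fintype.card V
  plotGraph : SimpleGraph V
  value : N → V → ℝ
  value_mem : ∀ i v, value i v ∈ Set.Icc (0 : ℝ) 1
  friends : SimpleGraph N
  weight : N → N → ℝ
  weight_nonneg : ∀ i j, friends.Adj i j → 0 ≤ weight i j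

/-- The list of (agent, plot) assignments made so far, in chronological order. -/
abbrev History (N V : Type*) := List (N × V)

/-- A strategy profile: the plot that each agent takes when it is her turn to choose after a given
history. -/
abbrev Strategy (N V : Type*) := N → History N V → V

namespace LandInstance

variable {N V : Type*} [Fintype N] [Fintype V] (I : LandInstance N V)

/-- Utility of agent `i` under the allocation `A`. -/
noncomputable def utility (A : N ≃ V) (i : N) : ℝ :=
  open scoped Classical in
  I.value i (A i) +
    ∑ j, if I.friends.Adj i j ∧ I.plotGraph.Adj (A i) (A j) then I.weight i j else 0

/-- Social welfare: the sum of the agents' utilities. -/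
noncomputable def socialWelfare (A : N ≃ V) : ℝ := ∑ i, I.utility A i

/-- The maximum social welfare over all allocations. -/
noncomputable def opt : ℝ :=
  open scoped Classical in
  (Finset.univ : Finset (N ≃ V)).sup'
    ⟨Fintype.equivOfCardEq I.card_eq, Finset.mem_univ _⟩ I.socialWelfare

/-- Expected social welfare of a random allocation. -/
noncomputable def expectedWelfare (μ : PMF (N ≃ V)) : ℝ :=
  open scoped Classical in ∑ A, (μ A).toReal * I.socialWelfare A

/-- All plot values are `0` or `1`. -/
def IsBinary : Prop := ∀ i v, I.value i v = 0 ∨ I.value i v = 1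

/-- All friendships have the same positive weight `φ`. -/
def FriendshipUniform (φ : ℝ) : Prop :=
  0 < φ ∧ ∀ i j, I.friends.Adj i j → I.weight i j = φ

/-- Every agent has at most one friend. -/
def AtMostOneFriend : Prop :=
  ∀ i j k, I.friends.Adj i j → I.friends.Adj i k → j = k

/-- Friendship reports (`none` stands for "no friend") are truthful. -/
def Truthful (report : N → Option N) : Prop :=
  ∀ i j, report i = some j ↔ I.friends.Adj i j

/-- Plots that are not occupied after `h`. -/
noncomputable def free (h : History N V) : Finset V :=
  open scoped Classical in Finset.univ.filter fun v => v ∉ h.map Prod.snd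

/-- Agents that have no plot after `h`. -/
noncomputable def waiting (h : History N V) : Finset N :=
  open scoped Classical in Finset.univ.filter fun i => i ∉ h.map Prod.fst

/-- The ordered versions `(i, j)` and `(j, i)` of all pairs of agents who report each other as
friends and have no plots yet. -/
noncomputable def pairs (report : N → Option N) (h : History N V) : Finset (N × N) :=
  open scoped Classical in
  Finset.univ.filter fun p => p.1 ≠ p.2 ∧ report p.1 = some p.2 ∧ report p.2 = some p.1 ∧
    p.1 ∈ waiting h ∧ p.2 ∈ waiting h

/-- The friends-first phase is on: some pair is left, and two adjacent plots are unoccupied. -/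
def PairPhase (report : N → Option N) (h : History N V) : Prop :=
  (pairs report h).Nonempty ∧ ∃ v ∈ free h, ∃ w ∈ free h, I.plotGraph.Adj v w

/-- The waiting agents who report a positive value for some unoccupied plot. -/
noncomputable def interested (h : History N V) : Finset N :=
  open scoped Classical in (waiting h).filter fun i => ∃ v ∈ free h, 0 < I.value i v

/-- The random allocation produced from the history `h` on, for the strategies `s`, where `complete`
is the way in which the mechanism finally pairs the remaining agents with the remaining plots. The
first argument bounds the number of rounds; each round seats at least one agent.

While the friends-first phase is on, a round draws an ordered pair uniformly, that is, a uniform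
unordered pair and then a uniform order; its members choose their plots in this order. Afterwards a
round draws a uniform interested agent, who chooses a plot. When nobody is interested any more, the
remaining agents and plots are paired arbitrarily. -/
noncomputable def run (report : N → Option N) (s : Strategy N V)
    (complete : History N V → (N ≃ V)) : ℕ → History N V → PMF (N ≃ V)
  | 0, h => PMF.pure (complete h)
  | k + 1, h =>
    open scoped Classical in
    if hp : I.PairPhase report h then
      (PMF.uniformOfFinset (pairs report h) hp.1).bind fun p =>
        let h' := h ++ [(p.1, s p.1 h)]
        run report s complete k (h' ++ [(p.2, s p.2 h')])
    else if hi : (I.interested h).Nonempty then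
      (PMF.uniformOfFinset (I.interested h) hi).bind fun i =>
        run report s complete k (h ++ [(i, s i h)])
    else PMF.pure (complete h)

/-- The output of Friends-First Choose-Together RSD*. Every round seats an agent, so `|N|` rounds
suffice. -/
noncomputable def ffctrsd (report : N → Option N) (s : Strategy N V)
    (complete : History N V → (N ≃ V)) : PMF (N ≃ V) :=
  I.run report s complete (Fintype.card N) []

/-- No agent and no plot is assigned twice in `h`. -/
def IsPartialMatching (h : History N V) : Prop :=
  (h.map Prod.fst).Nodup ∧ (h.map Prod.snd).Nodup

/-- `complete` extends every partial matching to an allocation (in an arbitrary way). -/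
def IsCompletion (complete : History N V → (N ≃ V)) : Prop :=
  ∀ h, IsPartialMatching h → ∀ p ∈ h, complete h p.1 = p.2

/-- Utility that agent `i` has from the plot `v` when the agents in `h` are seated as in `h`, and
no other friend of hers will be next to her. -/
noncomputable def utilityGiven (h : History N V) (i : N) (v : V) : ℝ :=
  open scoped Classical in
  I.value i v +
    (h.map fun p => if I.friends.Adj i p.1 ∧ I.plotGraph.Adj v p.2 then I.weight i p.1 else 0).sum

/-- All agents choose optimally, ties being broken arbitrarily: an agent `i` who moves first in a
pair `(i, j)` maximizes her own utility, anticipating the choice that `j` makes right after her;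
any other agent (the second mover of a pair, or an agent who chooses in the RSD* phase) chooses an
unoccupied plot that is best for her given the plots of the agents who are already seated. -/
structure IsOptimal (report : N → Option N) (s : Strategy N V) : Prop where
  mem_free : ∀ h i, IsPartialMatching h → i ∈ waiting h → s i h ∈ free h
  first : ∀ h i j, IsPartialMatching h → I.PairPhase report h → (i, j) ∈ pairs report h →
    ∀ v ∈ free h,
      I.utilityGiven (h ++ [(j, s j (h ++ [(i, v)]))]) i v ≤
        I.utilityGiven (h ++ [(j, s j (h ++ [(i, s i h)]))]) i (s i h)
  other : ∀ h i, IsPartialMatching h → i ∈ waiting h →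
    (¬ (I.PairPhase report h ∧ ∃ j, (i, j) ∈ pairs report h)) →
    ∀ v ∈ free h, I.utilityGiven h i v ≤ I.utilityGiven h i (s i h)

end LandInstance

/-! Fix an optimal allocation `O` and let c = φ / (4φ + 4). The `potential` is c times a count of
what `O` could still realize: live values, plus φ times the smaller of the numbers of waiting
ordered pairs and of live ordered edges. It starts at c · SW(`O`), and it vanishes when the
mechanism stops choosing. So it suffices that, on average, each round adds at least as much welfare
as it removes potential; `banked_add_potential_le` is this induction.

Seating one agent destroys at most two live values and at most two live ordered edges. A pair round
therefore lowers each count by at most 4, which costs 4c(1 + φ) = φ. By `round_gain` the pair earns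
φ unless the first mover, indifferent among all free plots, can take the only plot her friend
values, a plot without free neighbours (`Blockable`). Then each order of the pair costs only φ/2,
while the opposite order earns at least 1 > φ, so averaging over the two orders pays for both. In
the RSD* phase a choice earns 1 and costs at most 2c ≤ 1.

The minimum with the number of pairs makes the edge term vanish as soon as the friends-first phase
ends, for whichever reason it ends. -/

namespace LandInstance

/-! ### The two-move game of a pair of friends -/

section Game

variable {V : Type*} (G : SimpleGraph V) (φ : ℝ)

/-- The utility `φ` of living next to a friend, if the plots `v` and `w` are adjacent. -/
noncomputable def bonus (v w : V) : ℝ :=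
  open scoped Classical in if G.Adj v w then φ else 0

variable {G φ}

lemma bonus_comm (v w : V) : bonus G φ v w = bonus G φ w v := by
  classical
  unfold bonus
  exact if_congr (G.adj_comm v w) rfl rfl

lemma bonus_nonneg (h0 : 0 < φ) (v w : V) : 0 ≤ bonus G φ v w := by
  unfold bonus; split_ifs <;> linarith

lemma bonus_le (h0 : 0 < φ) (v w : V) : bonus G φ v w ≤ φ := by
  unfold bonus; split_ifs <;> linarith

lemma bonus_of_adj {v w : V} (h : G.Adj v w) : bonus G φ v w = φ := by simp [bonus, h]

/-- Value beats friendship: a maximizer of value plus bonus has positive value if some available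
plot has. -/
lemma eq_one_of_best (h1 : φ < 1) {g : V → ℝ} (hg : ∀ x, g x = 0 ∨ g x = 1) {u : V}
    {a b : ℝ} (ha : 0 ≤ a) (hb : b ≤ φ) {v : V} (hu : g u = 1) (hle : g u + a ≤ g v + b) :
    g v = 1 := by
  rcases hg v with h | h
  · linarith
  · exact h

/-- The situation in which a first mover with plot values `f` can ruin her friend with plot values
`g`: she herself values no unoccupied plot, and her friend values only the plot `w`, which has no
unoccupied neighbour. -/
def Blockable (G : SimpleGraph V) (F : Finset V) (f g : V → ℝ) (w : V) : Prop :=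
  (∀ x ∈ F, f x = 0) ∧ w ∈ F ∧ g w = 1 ∧ (∀ x ∈ F, g x = 1 → x = w) ∧ ∀ x ∈ F, ¬ G.Adj w x

/-- `r x` is a best unoccupied plot for an agent with plot values `g` whose friend took `x`. -/
def BestResponse (G : SimpleGraph V) (φ : ℝ) (F : Finset V) (g : V → ℝ) (r : V → V) : Prop :=
  ∀ x ∈ F, r x ∈ F ∧ r x ≠ x ∧
    ∀ y ∈ F, y ≠ x → g y + bonus G φ y x ≤ g (r x) + bonus G φ (r x) x

/-- `v` is a best unoccupied plot for a first mover with plot values `f` who anticipates `r`. -/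
def BestFirst (G : SimpleGraph V) (φ : ℝ) (F : Finset V) (f : V → ℝ) (r : V → V) (v : V) : Prop :=
  v ∈ F ∧ ∀ x ∈ F, f x + bonus G φ x (r x) ≤ f v + bonus G φ v (r v)

variable {F : Finset V} {f g : V → ℝ} {r : V → V} {v : V}

lemma BestResponse.eq_one (h0 : 0 < φ) (h1 : φ < 1) (hg : ∀ x, g x = 0 ∨ g x = 1)
    (hr : BestResponse G φ F g r) {x u : V} (hx : x ∈ F) (hu : u ∈ F) (hux : u ≠ x)
    (hgu : g u = 1) : g (r x) = 1 :=
  eq_one_of_best h1 hg (bonus_nonneg h0 _ _) (bonus_le h0 _ _) hgu ((hr x hx).2.2 u hu hux)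

lemma BestFirst.eq_one (h0 : 0 < φ) (h1 : φ < 1) (hf : ∀ x, f x = 0 ∨ f x = 1)
    (hv : BestFirst G φ F f r v) {u : V} (hu : u ∈ F) (hfu : f u = 1) : f v = 1 :=
  eq_one_of_best h1 hf (bonus_nonneg h0 _ _) (bonus_le h0 _ _) hfu (hv.2 u hu)

/-- With no value left to gain, a free neighbour of `x` is worth φ to the second mover, so her best
response must also be a neighbour of `x`. -/
lemma BestResponse.bonus_eq (h0 : 0 < φ) (hg : ∀ x, g x = 0 ∨ g x = 1)
    (hr : BestResponse G φ F g r) {x y : V} (hx : x ∈ F) (hy : y ∈ F) (hxy : G.Adj x y)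
    (hz : ∀ u ∈ F, u ≠ x → g u ≠ 1) : bonus G φ x (r x) = φ := by
  obtain ⟨hrF, hne, hbest⟩ := hr x hx
  have hyx : y ≠ x := hxy.ne'
  have h := hbest y hy hyx
  rw [bonus_of_adj hxy.symm, (hg y).resolve_right (hz y hy hyx),
    (hg _).resolve_right (hz _ hrF hne)] at h
  rw [bonus_comm]
  exact le_antisymm (bonus_le h0 _ _) (by linarith)

/-- Two friends who choose together gain at least `φ`, unless the first mover can ruin her
friend. -/
lemma round_gain (h0 : 0 < φ) (h1 : φ < 1) (hf : ∀ x, f x = 0 ∨ f x = 1)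
    (hg : ∀ x, g x = 0 ∨ g x = 1) (hr : BestResponse G φ F g r) (hv : BestFirst G φ F f r v)
    (hadj : ∃ a ∈ F, ∃ b ∈ F, G.Adj a b) :
    φ ≤ f v + g (r v) + 2 * bonus G φ v (r v) ∨ ∃ w, Blockable G F f g w := by
  have hf0 : ∀ x, 0 ≤ f x := fun x => by rcases hf x with h | h <;> linarith
  have hg0 : ∀ x, 0 ≤ g x := fun x => by rcases hg x with h | h <;> linarith
  have hb := bonus_nonneg (G := G) h0 v (r v)
  have := hf0 v
  have := hg0 (r v)
  by_cases hi : ∃ u ∈ F, f u = 1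
  · obtain ⟨u, hu, hfu⟩ := hi
    have := hv.eq_one h0 h1 hf hu hfu
    left; linarith
  have hi0 : ∀ x ∈ F, f x = 0 := fun x hx => (hf x).resolve_right fun h => hi ⟨x, hx, h⟩
  by_cases hj : ∃ u ∈ F, u ≠ v ∧ g u = 1
  · obtain ⟨u, hu, huv, hgu⟩ := hj
    have := hr.eq_one h0 h1 hg hv.1 hu huv hgu
    left; linarith
  have hj0 : ∀ u ∈ F, u ≠ v → g u ≠ 1 := fun u hu huv h => hj ⟨u, hu, huv, h⟩
  by_cases hnb : ∃ x ∈ F, G.Adj v x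
  · obtain ⟨x, hx, hvx⟩ := hnb
    have := hr.bonus_eq h0 hg hv.1 hx hvx hj0
    left; linarith
  have hx0 : ∀ x ∈ F, ¬ G.Adj v x := fun x hx h => hnb ⟨x, hx, h⟩
  -- Here `v` has no free neighbour and is the only free plot the friend may value; if she does
  -- value it, the situation is blockable.
  by_cases hgv : g v = 1
  · exact Or.inr ⟨v, hi0, hv.1, hgv, fun x hx h => by
      by_contra hne
      exact hj0 x hx hne h, hx0⟩
  -- Neither friend values any free plot. An endpoint of a free edge would secure the bonus φ, so
  -- the optimal first move does at least as well.
  obtain ⟨a, ha, b, hb', hab⟩ := hadj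
  have hall : ∀ u ∈ F, g u ≠ 1 := fun u hu h => by
    by_cases huv : u = v
    · exact hgv (huv ▸ h)
    · exact hj0 u hu huv h
  have h2 := hr.bonus_eq h0 hg ha hb' hab fun u hu _ => hall u hu
  have h3 := hv.2 a ha
  rw [hi0 a ha, h2, hi0 v hv.1] at h3
  left; linarith

/-- If the first mover leaves `w` free, her friend takes it, because value beats the bonus. -/
lemma Blockable.taken (h0 : 0 < φ) (h1 : φ < 1) (hg : ∀ x, g x = 0 ∨ g x = 1)
    (hr : BestResponse G φ F g r) (hv : v ∈ F) {w : V}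
    (hw : Blockable G F f g w) : v = w ∨ r v = w := by
  by_cases h : v = w
  · exact Or.inl h
  · exact Or.inr (hw.2.2.2.1 _ (hr v hv).1
      (hr.eq_one h0 h1 hg hv hw.2.1 (Ne.symm h) hw.2.2.1))

/-- The opposite order: the agent who values only `w` now moves first and cannot be ruined. -/
lemma Blockable.first_eq (h0 : 0 < φ) (h1 : φ < 1) (hg : ∀ x, g x = 0 ∨ g x = 1)
    (hv : BestFirst G φ F g r v) {w : V} (hw : Blockable G F f g w) : g v = 1 ∧ v = w := by
  have := hv.eq_one h0 h1 hg hw.2.1 hw.2.2.1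
  exact ⟨this, hw.2.2.2.1 v hv.1 this⟩

end Game

/-! ### Histories and the welfare already secured -/

section Histories

variable {N V : Type*} {h : History N V} {i j : N} {v w : V}

lemma mem_free [Fintype V] {x : V} : x ∈ free h ↔ x ∉ h.map Prod.snd := by simp [free]

lemma mem_waiting [Fintype N] {x : N} : x ∈ waiting h ↔ x ∉ h.map Prod.fst := by simp [waiting]

lemma mem_free_append [Fintype V] {x : V} : x ∈ free (h ++ [(i, v)]) ↔ x ∈ free h ∧ x ≠ v := by
  simp only [mem_free, List.map_append, List.mem_append, not_or]; simp

lemma mem_waiting_append [Fintype N] {x : N} : x ∈ waiting (h ++ [(i, v)]) ↔ x ∈ waiting h ∧ x ≠ i := by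
  simp only [mem_waiting, List.map_append, List.mem_append, not_or]; simp

lemma IsPartialMatching.append [Fintype N] [Fintype V] (hm : IsPartialMatching h) (hi : i ∈ waiting h) (hv : v ∈ free h) :
    IsPartialMatching (h ++ [(i, v)]) := by
  rw [mem_waiting] at hi
  rw [mem_free] at hv
  refine ⟨?_, ?_⟩
  · rw [List.map_append]
    refine hm.1.append (List.nodup_singleton _) ?_
    simpa [List.disjoint_singleton] using hi
  · rw [List.map_append]
    refine hm.2.append (List.nodup_singleton _) ?_
    simpa [List.disjoint_singleton] using hv

lemma card_waiting_append [Fintype N] (hi : i ∈ waiting h) :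
    (waiting (h ++ [(i, v)])).card < (waiting h).card := by
  apply Finset.card_lt_card
  rw [Finset.ssubset_iff_of_subset fun x hx => (mem_waiting_append.1 hx).1]
  exact ⟨i, hi, fun h => (mem_waiting_append.1 h).2 rfl⟩

variable [Fintype N] [Fintype V] (I : LandInstance N V)

lemma mem_pairs {report : N → Option N} (hreport : I.Truthful report) {p : N × N} :
    p ∈ pairs report h ↔ I.friends.Adj p.1 p.2 ∧ p.1 ∈ waiting h ∧ p.2 ∈ waiting h := by
  simp only [pairs, Finset.mem_filter, Finset.mem_univ, true_and, hreport _ _]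
  exact ⟨fun H => ⟨H.2.1, H.2.2.2⟩, fun H => ⟨H.1.ne, H.1, H.1.symm, H.2⟩⟩

lemma swap_mem_pairs {report : N → Option N} (hreport : I.Truthful report) {p : N × N} :
    p.swap ∈ pairs report h ↔ p ∈ pairs report h := by
  simp only [mem_pairs I hreport, Prod.fst_swap, Prod.snd_swap, I.friends.adj_comm p.2 p.1]
  tauto

/-- Welfare created by the assignments in `T` alone. -/
noncomputable def banked (T : Finset (N × V)) : ℝ :=
  open scoped Classical in
  ∑ p ∈ T, I.value p.1 p.2 + ∑ q ∈ T ×ˢ T,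
    if I.friends.Adj q.1.1 q.2.1 ∧ I.plotGraph.Adj q.1.2 q.2.2 then I.weight q.1.1 q.2.1 else 0

lemma value_nonneg (i : N) (v : V) : 0 ≤ I.value i v := (I.value_mem i v).1

lemma banked_mono {S T : Finset (N × V)} (hST : S ⊆ T) : I.banked S ≤ I.banked T := by
  classical
  unfold banked
  refine add_le_add (Finset.sum_le_sum_of_subset_of_nonneg hST fun _ _ _ => I.value_nonneg _ _)
    (Finset.sum_le_sum_of_subset_of_nonneg (Finset.product_subset_product hST hST) fun q _ _ => ?_)
  split_ifs with H
  · exact I.weight_nonneg _ _ H.1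
  · exact le_rfl

lemma banked_allocation [DecidableEq N] [DecidableEq V] (A : N ≃ V) :
    I.banked (Finset.univ.image fun i => (i, A i)) = I.socialWelfare A := by
  have hinj : ∀ x ∈ (Finset.univ : Finset N), ∀ y ∈ (Finset.univ : Finset N),
      (x, A x) = (y, A y) → x = y := fun x _ y _ h => (Prod.ext_iff.1 h).1
  unfold banked socialWelfare utility
  rw [Finset.sum_product, Finset.sum_image hinj, Finset.sum_image hinj, ← Finset.sum_add_distrib]
  refine Finset.sum_congr rfl fun i _ => ?_
  rw [Finset.sum_image hinj]

lemma banked_le_socialWelfare [DecidableEq N] [DecidableEq V] {A : N ≃ V}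
    (hA : ∀ p ∈ h, A p.1 = p.2) :
    I.banked h.toFinset ≤ I.socialWelfare A := by
  rw [← I.banked_allocation A]
  refine I.banked_mono fun p hp => ?_
  rw [Finset.mem_image]
  exact ⟨p.1, Finset.mem_univ _, Prod.ext rfl (hA p (List.mem_toFinset.1 hp))⟩

lemma banked_insert [DecidableEq N] [DecidableEq V] {T : Finset (N × V)} {x : N × V}
    (hx : x ∉ T) : I.banked T + I.value x.1 x.2 ≤ I.banked (insert x T) := by
  have hnn : ∀ q : (N × V) × (N × V), q ∈ insert x T ×ˢ insert x T → q ∉ T ×ˢ T →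
      (0 : ℝ) ≤ open scoped Classical in
        if I.friends.Adj q.1.1 q.2.1 ∧ I.plotGraph.Adj q.1.2 q.2.2 then I.weight q.1.1 q.2.1
        else 0 := by
    intro q _ _
    split_ifs with H
    · exact I.weight_nonneg _ _ H.1
    · exact le_rfl
  have := Finset.sum_le_sum_of_subset_of_nonneg
    (Finset.product_subset_product (Finset.subset_insert x T) (Finset.subset_insert x T)) hnn
  unfold banked
  rw [Finset.sum_insert hx]
  linarith

/-- Both friends receive the bonus, one for each ordered pair, hence the factor 2. All other new
interactions are nonnegative and are dropped. -/
lemma banked_insert_insert [DecidableEq N] [DecidableEq V] {φ : ℝ} (huni : I.FriendshipUniform φ)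
    {T : Finset (N × V)} {x y : N × V} (hx : x ∉ T) (hy : y ∉ T) (hxy : I.friends.Adj x.1 y.1) :
    I.banked T + (I.value x.1 x.2 + I.value y.1 y.2 + 2 * bonus I.plotGraph φ x.2 y.2) ≤
      I.banked (insert y (insert x T)) := by
  have hne : x ≠ y := fun e => hxy.ne (congrArg Prod.fst e)
  have hy' : y ∉ insert x T := by simp [hy, hne.symm]
  let c : (N × V) × (N × V) → ℝ := fun q => open scoped Classical in
    if I.friends.Adj q.1.1 q.2.1 ∧ I.plotGraph.Adj q.1.2 q.2.2 then I.weight q.1.1 q.2.1 else 0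
  have hnn : ∀ q, 0 ≤ c q := by
    intro q
    simp only [c]
    split_ifs with H
    · exact I.weight_nonneg _ _ H.1
    · exact le_rfl
  classical
  have hcxy : c (x, y) = bonus I.plotGraph φ x.2 y.2 := by
    simp only [c, huni.2 _ _ hxy]
    exact if_congr (and_iff_right hxy) rfl rfl
  have hcyx : c (y, x) = bonus I.plotGraph φ x.2 y.2 := by
    simp only [c, huni.2 _ _ hxy.symm]
    exact if_congr ((and_iff_right hxy.symm).trans (I.plotGraph.adj_comm _ _)) rfl rfl
  have hsub : insert (x, y) (insert (y, x) (T ×ˢ T)) ⊆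
      insert y (insert x T) ×ˢ insert y (insert x T) := by
    intro q hq
    simp only [Finset.mem_insert, Finset.mem_product] at hq ⊢
    rcases hq with rfl | rfl | hq <;> simp_all
  have key := Finset.sum_le_sum_of_subset_of_nonneg hsub fun q _ _ => hnn q
  rw [Finset.sum_insert (by simp [hx, hne]), Finset.sum_insert (by simp [hx]), hcxy, hcyx] at key
  unfold banked
  rw [Finset.sum_insert hy', Finset.sum_insert hx]
  linarith

end Histories

/-! ### From optimal strategies to best responses -/

section Behaviour

variable {N V : Type*} [Fintype N] [Fintype V] (I : LandInstance N V)
  {h : History N V} {i j : N} {v w : V} {φ : ℝ}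

lemma utilityGiven_of_no_friend (hno : ∀ p ∈ h, ¬ I.friends.Adj i p.1) (v : V) :
    I.utilityGiven h i v = I.value i v := by
  unfold utilityGiven
  rw [add_eq_left]
  refine List.sum_eq_zero fun x hx => ?_
  obtain ⟨p, hp, rfl⟩ := List.mem_map.1 hx
  exact if_neg fun H => hno p hp H.1

lemma utilityGiven_append (huni : I.FriendshipUniform φ) (hij : I.friends.Adj i j)
    (hno : ∀ p ∈ h, ¬ I.friends.Adj i p.1) (v w : V) :
    I.utilityGiven (h ++ [(j, w)]) i v = I.value i v + bonus I.plotGraph φ v w := by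
  classical
  rw [← I.utilityGiven_of_no_friend hno v]
  unfold utilityGiven
  rw [List.map_append, List.sum_append, ← add_assoc, List.map_singleton, List.sum_singleton,
    huni.2 _ _ hij, add_right_inj]
  exact if_congr (and_iff_right hij) rfl rfl

lemma value_le_utilityGiven (h : History N V) (i : N) (v : V) :
    I.value i v ≤ I.utilityGiven h i v := by
  unfold utilityGiven
  refine le_add_of_nonneg_right (List.sum_nonneg fun x hx => ?_)
  obtain ⟨p, hp, rfl⟩ := List.mem_map.1 hx
  split_ifs with H
  · exact I.weight_nonneg _ _ H.1
  · exact le_rfl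

lemma utilityGiven_le (hone : I.AtMostOneFriend) (huni : I.FriendshipUniform φ)
    (hh : (h.map Prod.fst).Nodup) (i : N) (v : V) :
    I.utilityGiven h i v ≤ I.value i v + φ := by
  induction h with
  | nil => simpa [utilityGiven] using huni.1.le
  | cons p t ih =>
    rw [List.map_cons, List.nodup_cons] at hh
    by_cases hp : I.friends.Adj i p.1
    -- The only friend of `i` is seated here and cannot occur again, so at most one summand is
    -- nonzero.
    · have ht := I.utilityGiven_of_no_friend (h := t) (i := i) (fun q hq hiq => hh.1 <| by
        rw [hone _ _ _ hp hiq]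
        exact List.mem_map_of_mem hq) v
      unfold utilityGiven at ht ⊢
      rw [List.map_cons, List.sum_cons, huni.2 _ _ hp]
      have := huni.1
      split_ifs <;> linarith
    · have ht := ih hh.2
      unfold utilityGiven at ht ⊢
      rw [List.map_cons, List.sum_cons, if_neg fun H => hp H.1, zero_add]
      exact ht

lemma no_friend_seated (hone : I.AtMostOneFriend) (hij : I.friends.Adj i j) (hj : j ∈ waiting h) :
    ∀ p ∈ h, ¬ I.friends.Adj i p.1 := fun p hp hip => by
  rw [mem_waiting, hone _ _ _ hij hip] at hj
  exact hj (List.mem_map_of_mem hp)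

variable {report : N → Option N} {s : Strategy N V}

/-- An agent who chooses alone takes a plot of value `1` if there is one. -/
lemma IsOptimal.value_eq_one {I : LandInstance N V} (hs : I.IsOptimal report s)
    (hbin : I.IsBinary) (hone : I.AtMostOneFriend) (huni : I.FriendshipUniform φ) (hφ : φ < 1)
    (hm : IsPartialMatching h) (hp : ¬ I.PairPhase report h) (hi : i ∈ I.interested h) :
    I.value i (s i h) = 1 := by
  simp only [interested, Finset.mem_filter] at hi
  obtain ⟨hw, v, hv, hpos⟩ := hi
  have h1 := hs.other h i hm hw (fun H => hp H.1) v hv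
  have h2 := I.value_le_utilityGiven h i v
  have h3 := I.utilityGiven_le hone huni hm.1 i (s i h)
  have h4 := (hbin i v).resolve_left hpos.ne'
  rcases hbin i (s i h) with h5 | h5
  · linarith
  · exact h5

lemma IsOptimal.bestResponse {I : LandInstance N V} (hs : I.IsOptimal report s)
    (hone : I.AtMostOneFriend) (huni : I.FriendshipUniform φ) (hreport : I.Truthful report)
    (hm : IsPartialMatching h) (hij : (i, j) ∈ pairs report h) :
    BestResponse I.plotGraph φ (free h) (I.value j) fun x => s j (h ++ [(i, x)]) := by
  intro x hx
  obtain ⟨hadj, hi, hj⟩ := (mem_pairs I hreport).1 hij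
  have hm' := hm.append hi hx
  have hj' : j ∈ waiting (h ++ [(i, x)]) := mem_waiting_append.2 ⟨hj, hadj.ne'⟩
  have hfree := mem_free_append.1 (hs.mem_free _ j hm' hj')
  refine ⟨hfree.1, hfree.2, fun y hy hyx => ?_⟩
  -- Once `i` is seated, `j` has no waiting friend, so she falls under the rule for agents who are
  -- not first movers.
  have key := hs.other _ j hm' hj' (fun H => by
    obtain ⟨-, k, hk⟩ := H
    obtain ⟨hjk, -, hk⟩ := (mem_pairs I hreport).1 hk
    exact (mem_waiting_append.1 hk).2 (hone _ _ _ hjk hadj.symm)) y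
    (mem_free_append.2 ⟨hy, hyx⟩)
  have hno := I.no_friend_seated hone hadj.symm hi
  rwa [I.utilityGiven_append huni hadj.symm hno, I.utilityGiven_append huni hadj.symm hno] at key

lemma IsOptimal.bestFirst {I : LandInstance N V} (hs : I.IsOptimal report s)
    (hone : I.AtMostOneFriend) (huni : I.FriendshipUniform φ) (hreport : I.Truthful report)
    (hm : IsPartialMatching h) (hp : I.PairPhase report h) (hij : (i, j) ∈ pairs report h) :
    BestFirst I.plotGraph φ (free h) (I.value i) (fun x => s j (h ++ [(i, x)])) (s i h) := by
  obtain ⟨hadj, hi, hj⟩ := (mem_pairs I hreport).1 hij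
  refine ⟨hs.mem_free h i hm hi, fun x hx => ?_⟩
  have key := hs.first h i j hm hp hij x hx
  have hno := I.no_friend_seated hone hadj hj
  rwa [I.utilityGiven_append huni hadj hno, I.utilityGiven_append huni hadj hno] at key

end Behaviour

/-! ### The potential and its loss per round -/

section Potential

variable {N V : Type*} [Fintype N] [Fintype V] (I : LandInstance N V) (O : N ≃ V)
  {h : History N V} {i j : N} {v w : V} {φ : ℝ} {report : N → Option N}

/-- The waiting agents who get value `1` from an unoccupied plot under `O`. -/
noncomputable def liveValues (h : History N V) : Finset N :=
  open scoped Classical in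
  Finset.univ.filter fun i => i ∈ waiting h ∧ O i ∈ free h ∧ I.value i (O i) = 1

/-- The ordered pairs of friends to whom `O` assigns adjacent plots that are both unoccupied. -/
noncomputable def liveEdges (h : History N V) : Finset (N × N) :=
  open scoped Classical in
  Finset.univ.filter fun p => I.friends.Adj p.1 p.2 ∧ I.plotGraph.Adj (O p.1) (O p.2) ∧
    O p.1 ∈ free h ∧ O p.2 ∈ free h

/-- Lower bound on the welfare that is still to come after `h`. -/
noncomputable def potential (φ : ℝ) (report : N → Option N) (h : History N V) : ℝ :=
  φ / (4 * φ + 4) * ((I.liveValues O h).card +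
    φ * (min (pairs report h).card (I.liveEdges O h).card : ℕ))

/-- The denominator 4φ + 4 is chosen so that a drop of `a` in every count costs exactly φ/4 · `a`.
-/
lemma potential_le {a : ℕ} {h' : History N V} (h0 : 0 < φ)
    (hv : (I.liveValues O h).card ≤ (I.liveValues O h').card + a)
    (hp : (pairs report h).card ≤ (pairs report h').card + a)
    (he : (I.liveEdges O h).card ≤ (I.liveEdges O h').card + a) :
    I.potential O φ report h ≤ I.potential O φ report h' + φ / 4 * a := by
  have hmin : min (pairs report h).card (I.liveEdges O h).card ≤
      min (pairs report h').card (I.liveEdges O h').card + a := by omega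
  have hv' : ((I.liveValues O h).card : ℝ) ≤ (I.liveValues O h').card + a := by exact_mod_cast hv
  have hmin' : ((min (pairs report h).card (I.liveEdges O h).card : ℕ) : ℝ) ≤
      (min (pairs report h').card (I.liveEdges O h').card : ℕ) + a := by exact_mod_cast hmin
  have hc : φ / 4 * a = φ / (4 * φ + 4) * (a + φ * a) := by
    field_simp
    ring
  unfold potential
  rw [hc, ← mul_add]
  refine mul_le_mul_of_nonneg_left ?_ (by positivity)
  have := mul_le_mul_of_nonneg_left hmin' h0.le
  linarith

lemma card_le_card_add {α : Type*} {s t u : Finset α} {a : ℕ} (hu : u.card ≤ a)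
    (hst : ∀ x ∈ s, x ∉ u → x ∈ t) : s.card ≤ t.card + a := by
  classical
  have : s ⊆ t ∪ u := fun x hx => by
    by_cases hxu : x ∈ u
    · exact Finset.mem_union_right _ hxu
    · exact Finset.mem_union_left _ (hst x hx hxu)
  exact (Finset.card_le_card this).trans ((Finset.card_union_le _ _).trans (by omega))

/-- Only the seated agent and the agent whom `O` sends to the occupied plot can be lost. -/
lemma card_liveValues_append (h : History N V) (i : N) (v : V) :
    (I.liveValues O h).card ≤ (I.liveValues O (h ++ [(i, v)])).card + 2 := by
  classical
  refine card_le_card_add (u := {i, O.symm v}) Finset.card_le_two fun x hx hxu => ?_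
  simp only [liveValues, Finset.mem_filter, Finset.mem_univ, true_and, mem_waiting_append,
    mem_free_append, Finset.mem_insert, Finset.mem_singleton, not_or, Equiv.eq_symm_apply]
    at hx hxu ⊢
  tauto

/-- Live edges depend on free plots, not on waiting agents. The agent whom `O` sends to `v` has at
most one friend, so only the two orientations of one edge can die. -/
lemma card_liveEdges_append (hone : I.AtMostOneFriend) (h : History N V) (i : N) (v : V) :
    (I.liveEdges O h).card ≤ (I.liveEdges O (h ++ [(i, v)])).card + 2 := by
  classical
  by_cases hf : ∃ b, I.friends.Adj (O.symm v) b
  · obtain ⟨b, hb⟩ := hf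
    refine card_le_card_add (u := {(O.symm v, b), (b, O.symm v)}) Finset.card_le_two
      fun x hx hxu => ?_
    simp only [liveEdges, Finset.mem_filter, Finset.mem_univ, true_and,
      mem_free_append, Finset.mem_insert, Finset.mem_singleton, not_or] at hx hxu ⊢
    refine ⟨hx.1, hx.2.1, ⟨hx.2.2.1, fun e => hxu.1 ?_⟩, hx.2.2.2, fun e => hxu.2 ?_⟩
    · have e' : x.1 = O.symm v := (Equiv.eq_symm_apply O).2 e
      exact Prod.ext e' (hone _ _ _ (e' ▸ hx.1) hb)
    · have e' : x.2 = O.symm v := (Equiv.eq_symm_apply O).2 e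
      exact Prod.ext (hone _ _ _ (e' ▸ hx.1.symm) hb) e'
  · refine (Finset.card_le_card fun x hx => ?_).trans (Nat.le_add_right _ _)
    simp only [liveEdges, Finset.mem_filter, Finset.mem_univ, true_and, mem_free_append] at hx ⊢
    refine ⟨hx.1, hx.2.1, ⟨hx.2.2.1, fun e => hf ?_⟩, hx.2.2.2, fun e => hf ?_⟩
    · exact ⟨x.2, (Equiv.eq_symm_apply O).2 e ▸ hx.1⟩
    · exact ⟨x.1, (Equiv.eq_symm_apply O).2 e ▸ hx.1.symm⟩

/-- Occupying a plot without unoccupied neighbours destroys no live edge. -/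
lemma card_liveEdges_append_of_isolated
    (hiso : ∀ x ∈ free h, ¬ I.plotGraph.Adj v x) (i : N) :
    (I.liveEdges O h).card ≤ (I.liveEdges O (h ++ [(i, v)])).card := by
  refine Finset.card_le_card fun x hx => ?_
  simp only [liveEdges, Finset.mem_filter, Finset.mem_univ, true_and, mem_free_append] at hx ⊢
  refine ⟨hx.1, hx.2.1, ⟨hx.2.2.1, fun e => ?_⟩, hx.2.2.2, fun e => ?_⟩
  · exact hiso _ hx.2.2.2 (e ▸ hx.2.1)
  · exact hiso _ hx.2.2.1 (e ▸ hx.2.1.symm)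

lemma card_pairs_append (hone : I.AtMostOneFriend) (hreport : I.Truthful report)
    (hij : I.friends.Adj i j) (v w : V) :
    (pairs report h).card ≤ (pairs report (h ++ [(i, v)] ++ [(j, w)])).card + 2 := by
  classical
  refine card_le_card_add (u := {(i, j), (j, i)}) Finset.card_le_two fun x hx hxu => ?_
  rw [mem_pairs I hreport] at hx ⊢
  simp only [mem_waiting_append, Finset.mem_insert, Finset.mem_singleton, not_or] at hxu ⊢
  obtain ⟨a, b⟩ := x
  obtain ⟨hab, ha, hb⟩ := hx
  simp only at hab ha hb
  refine ⟨hab, ⟨⟨ha, ?_⟩, ?_⟩, ⟨hb, ?_⟩, ?_⟩ <;> rintro rfl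
  · exact hxu.1 (Prod.ext rfl (hone _ _ _ hab hij))
  · exact hxu.2 (Prod.ext rfl (hone _ _ _ hab hij.symm))
  · exact hxu.2 (Prod.ext (hone _ _ _ hab.symm hij) rfl)
  · exact hxu.1 (Prod.ext (hone _ _ _ hab.symm hij.symm) rfl)

/-- Seating a pair costs at most `φ` of potential. -/
lemma potential_append_append (hone : I.AtMostOneFriend) (hreport : I.Truthful report)
    (h0 : 0 < φ) (hij : I.friends.Adj i j) (v w : V) :
    I.potential O φ report h ≤ I.potential O φ report (h ++ [(i, v)] ++ [(j, w)]) + φ := by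
  have h1 := I.card_liveValues_append O h i v
  have h2 := I.card_liveValues_append O (h ++ [(i, v)]) j w
  have h3 := I.card_liveEdges_append O hone h i v
  have h4 := I.card_liveEdges_append O hone (h ++ [(i, v)]) j w
  have h5 := I.card_pairs_append (h := h) hone hreport hij v w
  have := I.potential_le O (a := 4) (report := report) (h := h)
    (h' := h ++ [(i, v)] ++ [(j, w)]) h0 (by omega) (by omega) (by omega)
  push_cast at this
  linarith

/-- Seating a pair costs at most `φ / 2` of potential if one of them values no unoccupied plot and
the other only the plot `u`, which has no unoccupied neighbour and is taken. -/
lemma potential_append_append_of_blockable (hone : I.AtMostOneFriend) (hreport : I.Truthful report)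
    (h0 : 0 < φ) (hij : I.friends.Adj i j) {u : V}
    (hu : Blockable I.plotGraph (free h) (I.value i) (I.value j) u ∨
      Blockable I.plotGraph (free h) (I.value j) (I.value i) u)
    (huvw : v = u ∨ w = u) :
    I.potential O φ report h ≤ I.potential O φ report (h ++ [(i, v)] ++ [(j, w)]) + φ / 2 := by
  classical
  have hval : (I.liveValues O h).card ≤
      (I.liveValues O (h ++ [(i, v)] ++ [(j, w)])).card + 2 := by
    refine card_le_card_add (u := {O.symm v, O.symm w}) Finset.card_le_two fun x hx hxu => ?_
    simp only [liveValues, Finset.mem_filter, Finset.mem_univ, true_and, mem_waiting_append,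
      mem_free_append, Finset.mem_insert, Finset.mem_singleton, not_or, Equiv.eq_symm_apply]
      at hx hxu ⊢
    obtain ⟨hxw, hxf, hx1⟩ := hx
    have hne : O x ≠ u := by rcases huvw with rfl | rfl <;> tauto
    -- The seated agents cause no further loss: one values no free plot, and the other could be live
    -- only through `u`, whose owner under `O` is already counted.
    have aux : ∀ {a b : N}, Blockable I.plotGraph (free h) (I.value a) (I.value b) u →
        x ≠ a ∧ x ≠ b := by
      intro a b H
      refine ⟨?_, ?_⟩ <;> rintro rfl
      · have := H.1 _ hxf
        linarith
      · exact hne (H.2.2.2.1 _ hxf hx1)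
    have : x ≠ i ∧ x ≠ j := hu.elim aux fun H => (aux H).symm
    tauto
  have hedge : (I.liveEdges O h).card ≤
      (I.liveEdges O (h ++ [(i, v)] ++ [(j, w)])).card + 2 := by
    -- Occupying `u` kills no edge, so only the other plot of the pair can cost up to two.
    have hiso : ∀ x ∈ free h, ¬ I.plotGraph.Adj u x := hu.elim (·.2.2.2.2) (·.2.2.2.2)
    have h3 := I.card_liveEdges_append O hone h i v
    have h4 := I.card_liveEdges_append O hone (h ++ [(i, v)]) j w
    rcases huvw with rfl | rfl
    · have := I.card_liveEdges_append_of_isolated O hiso i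
      omega
    · have := I.card_liveEdges_append_of_isolated O (h := h ++ [(i, v)]) (fun x hx => hiso x (mem_free_append.1 hx).1) j
      omega
  have := I.potential_le O (a := 2) h0 hval (I.card_pairs_append (h := h) hone hreport hij v w)
    hedge
  push_cast at this
  linarith

/-- Once the friends-first phase is over, only values count. -/
lemma potential_of_not_pairPhase (hp : ¬ I.PairPhase report h) :
    I.potential O φ report h = φ / (4 * φ + 4) * (I.liveValues O h).card := by
  have : min (pairs report h).card (I.liveEdges O h).card = 0 := by
    by_contra hne
    have hpos := Nat.pos_of_ne_zero hne
    rw [lt_min_iff, Finset.card_pos, Finset.card_pos] at hpos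
    obtain ⟨hpair, p, hpe⟩ := hpos
    simp only [liveEdges, Finset.mem_filter, Finset.mem_univ, true_and] at hpe
    exact hp ⟨hpair, _, hpe.2.2.1, _, hpe.2.2.2, hpe.2.1⟩
  simp [potential, this]

end Potential

/-! ### Expected welfare of a uniform draw -/

section Expectation

variable {N V : Type*} [Fintype N] [Fintype V] (I : LandInstance N V)

lemma expectedWelfare_pure (A : N ≃ V) : I.expectedWelfare (PMF.pure A) = I.socialWelfare A := by
  classical
  unfold expectedWelfare
  rw [Finset.sum_eq_single A] <;> simp +contextual [PMF.pure_apply]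

lemma expectedWelfare_uniform_bind {α : Type*} [Fintype α] (S : Finset α) (hS : S.Nonempty)
    (f : α → PMF (N ≃ V)) :
    I.expectedWelfare ((PMF.uniformOfFinset S hS).bind f) =
      (S.card : ℝ)⁻¹ * ∑ a ∈ S, I.expectedWelfare (f a) := by
  classical
  have hb : ∀ A, (((PMF.uniformOfFinset S hS).bind f) A).toReal =
      ∑ a ∈ S, (S.card : ℝ)⁻¹ * (f a A).toReal := by
    intro A
    rw [PMF.bind_apply, tsum_fintype, ENNReal.toReal_sum fun a _ =>
      ENNReal.mul_ne_top (PMF.apply_ne_top _ _) (PMF.apply_ne_top _ _)]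
    rw [← Finset.sum_subset (Finset.subset_univ S)]
    · refine Finset.sum_congr rfl fun a ha => ?_
      rw [ENNReal.toReal_mul, PMF.uniformOfFinset_apply_of_mem hS ha]
      simp
    · intro a _ ha
      rw [PMF.uniformOfFinset_apply_of_notMem hS ha]
      simp
  unfold expectedWelfare
  simp_rw [hb, Finset.sum_mul, Finset.mul_sum]
  rw [Finset.sum_comm]
  simp_rw [mul_assoc]

/-- The hypothesis compares sums, not single terms, because one order of a blockable pair may lose
more than it gains. -/
lemma le_expectedWelfare_uniform_bind {α : Type*} [Fintype α] {S : Finset α} (hS : S.Nonempty)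
    {f : α → PMF (N ≃ V)} {x : ℝ} (hx : ∑ _a ∈ S, x ≤ ∑ a ∈ S, I.expectedWelfare (f a)) :
    x ≤ I.expectedWelfare ((PMF.uniformOfFinset S hS).bind f) := by
  have hc : (0 : ℝ) < S.card := by exact_mod_cast hS.card_pos
  rw [expectedWelfare_uniform_bind, inv_mul_eq_div, le_div_iff₀ hc]
  simpa [mul_comm] using hx

end Expectation

/-! ### Gain against loss, and the induction over rounds -/

section Main

variable {N V : Type*} [Fintype N] [Fintype V] {I : LandInstance N V} (O : N ≃ V)
  {h : History N V} {φ : ℝ} {report : N → Option N} {s : Strategy N V}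

/-- The history after the ordered pair `p` has chosen. -/
def seatPair (s : Strategy N V) (h : History N V) (p : N × N) : History N V :=
  h ++ [(p.1, s p.1 h)] ++ [(p.2, s p.2 (h ++ [(p.1, s p.1 h)]))]

/-- The welfare that the ordered pair `p` creates by choosing after `h`. -/
noncomputable def pairGain (I : LandInstance N V) (φ : ℝ) (s : Strategy N V) (h : History N V)
    (p : N × N) : ℝ :=
  I.value p.1 (s p.1 h) + I.value p.2 (s p.2 (h ++ [(p.1, s p.1 h)])) +
    2 * bonus I.plotGraph φ (s p.1 h) (s p.2 (h ++ [(p.1, s p.1 h)]))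

lemma pairGain_nonneg (h0 : 0 < φ) (p : N × N) : 0 ≤ I.pairGain φ s h p := by
  have h1 := I.value_nonneg p.1 (s p.1 h)
  have h2 := I.value_nonneg p.2 (s p.2 (h ++ [(p.1, s p.1 h)]))
  have h3 := bonus_nonneg (G := I.plotGraph) h0 (s p.1 h) (s p.2 (h ++ [(p.1, s p.1 h)]))
  unfold pairGain
  linarith

omit [Fintype V] in
lemma notMem_of_mem_waiting {x : N × V} (hx : x.1 ∈ waiting h) : x ∉ h := fun H =>
  mem_waiting.1 hx (List.mem_map_of_mem H)

lemma banked_append [DecidableEq N] [DecidableEq V] {i : N} (hi : i ∈ waiting h) (v : V) :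
    I.banked h.toFinset + I.value i v ≤ I.banked (h ++ [(i, v)]).toFinset := by
  have e : (h ++ [(i, v)]).toFinset = insert (i, v) h.toFinset := by
    ext; simp [or_comm]
  rw [e]
  exact I.banked_insert (x := (i, v)) fun H => notMem_of_mem_waiting hi (List.mem_toFinset.1 H)

lemma banked_seatPair [DecidableEq N] [DecidableEq V] (hreport : I.Truthful report)
    (huni : I.FriendshipUniform φ) {p : N × N} (hp : p ∈ pairs report h) :
    I.banked h.toFinset + I.pairGain φ s h p ≤ I.banked (seatPair s h p).toFinset := by
  obtain ⟨hadj, hi, hj⟩ := (mem_pairs I hreport).1 hp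
  have e : (seatPair s h p).toFinset =
      insert (p.2, s p.2 (h ++ [(p.1, s p.1 h)])) (insert (p.1, s p.1 h) h.toFinset) := by
    ext; simp [seatPair]; tauto
  rw [e]
  exact I.banked_insert_insert huni (x := (p.1, s p.1 h))
    (y := (p.2, s p.2 (h ++ [(p.1, s p.1 h)])))
    (fun H => notMem_of_mem_waiting hi (List.mem_toFinset.1 H))
    (fun H => notMem_of_mem_waiting hj (List.mem_toFinset.1 H)) hadj

variable (hbin : I.IsBinary) (hone : I.AtMostOneFriend) (huni : I.FriendshipUniform φ)
  (hφ : φ < 1) (hreport : I.Truthful report) (hs : I.IsOptimal report s)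
include hbin hone huni hφ hreport hs

/-- If the first mover of a pair can ruin her friend, then over both orders of the pair the gain
covers the loss of potential. -/
lemma potential_add_potential_swap_of_blockable (hm : IsPartialMatching h)
    (hp : I.PairPhase report h) {p : N × N} (hpair : p ∈ pairs report h) {u : V}
    (hu : Blockable I.plotGraph (free h) (I.value p.1) (I.value p.2) u) :
    2 * I.potential O φ report h ≤
      (I.pairGain φ s h p + I.potential O φ report (seatPair s h p)) +
      (I.pairGain φ s h p.swap + I.potential O φ report (seatPair s h p.swap)) := by
  obtain ⟨i, j⟩ := p
  have h0 := huni.1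
  have hadj := ((mem_pairs I hreport).1 hpair).1
  have hpair' : (j, i) ∈ pairs report h := (swap_mem_pairs I hreport).2 hpair
  have htaken := hu.taken h0 hφ (hbin j) (hs.bestResponse hone huni hreport hm hpair)
    (hs.bestFirst hone huni hreport hm hp hpair).1
  obtain ⟨hval, hfst⟩ := hu.first_eq h0 hφ (hbin j) (hs.bestFirst hone huni hreport hm hp hpair')
  have l1 := I.potential_append_append_of_blockable O hone hreport h0 hadj (Or.inl hu) htaken
  have l2 := I.potential_append_append_of_blockable O hone hreport h0 hadj.symm (Or.inr hu)
    (w := s i (h ++ [(j, s j h)])) (Or.inl hfst)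
  have g1 := pairGain_nonneg (I := I) (s := s) (h := h) h0 (i, j)
  -- This gain alone pays for both orders, whose losses of φ/2 add up to φ < 1.
  have g2 : 1 ≤ I.pairGain φ s h (j, i) := by
    have h2 := I.value_nonneg i (s i (h ++ [(j, s j h)]))
    have h3 := bonus_nonneg (G := I.plotGraph) h0 (s j h) (s i (h ++ [(j, s j h)]))
    simp only [pairGain]
    linarith
  simp only [Prod.swap_prod_mk, seatPair] at *
  linarith

lemma potential_add_potential_swap (hm : IsPartialMatching h)
    (hp : I.PairPhase report h) {p : N × N} (hpair : p ∈ pairs report h) :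
    2 * I.potential O φ report h ≤
      (I.pairGain φ s h p + I.potential O φ report (seatPair s h p)) +
      (I.pairGain φ s h p.swap + I.potential O φ report (seatPair s h p.swap)) := by
  have h0 := huni.1
  have hpair' := (swap_mem_pairs I hreport).2 hpair
  have hgain : ∀ q ∈ pairs report h, φ ≤ I.pairGain φ s h q ∨
      ∃ u, Blockable I.plotGraph (free h) (I.value q.1) (I.value q.2) u := fun q hq =>
    round_gain h0 hφ (hbin _) (hbin _) (hs.bestResponse hone huni hreport hm hq)
      (hs.bestFirst hone huni hreport hm hp hq) (by
        obtain ⟨-, a, ha, b, hb, hab⟩ := hp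
        exact ⟨a, ha, b, hb, hab⟩)
  have hloss : ∀ q ∈ pairs report h,
      I.potential O φ report h ≤ I.potential O φ report (seatPair s h q) + φ := fun q hq =>
    I.potential_append_append O hone hreport h0 ((mem_pairs I hreport).1 hq).1 _ _
  rcases hgain p hpair with g1 | ⟨u, hu⟩
  · rcases hgain p.swap hpair' with g2 | ⟨u, hu⟩
    · have l1 := hloss p hpair
      have l2 := hloss p.swap hpair'
      linarith
    · have := potential_add_potential_swap_of_blockable O hbin hone huni hφ hreport hs hm hp
        hpair' hu
      rw [Prod.swap_swap] at this
      linarith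
  · exact potential_add_potential_swap_of_blockable O hbin hone huni hφ hreport hs hm hp hpair hu

/-- In the RSD* phase a choice costs at most as much potential as it creates value. -/
lemma potential_le_of_interested (hm : IsPartialMatching h) (hp : ¬ I.PairPhase report h) {i : N}
    (hi : i ∈ I.interested h) :
    I.potential O φ report h ≤
      I.value i (s i h) + I.potential O φ report (h ++ [(i, s i h)]) := by
  have h0 := huni.1
  -- Waiting pairs and free plots only shrink, so the friends-first phase cannot resume.
  have hp' : ¬ I.PairPhase report (h ++ [(i, s i h)]) := by
    rintro ⟨⟨p, hpair⟩, a, ha, b, hb, hab⟩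
    rw [mem_pairs I hreport, mem_waiting_append, mem_waiting_append] at hpair
    exact hp ⟨⟨p, (mem_pairs I hreport).2 ⟨hpair.1, hpair.2.1.1, hpair.2.2.1⟩⟩,
      a, (mem_free_append.1 ha).1, b, (mem_free_append.1 hb).1, hab⟩
  rw [I.potential_of_not_pairPhase O hp, I.potential_of_not_pairPhase O hp',
    hs.value_eq_one hbin hone huni hφ hm hp hi]
  have hcard : ((I.liveValues O h).card : ℝ) ≤ (I.liveValues O (h ++ [(i, s i h)])).card + 2 := by
    exact_mod_cast I.card_liveValues_append O h i (s i h)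
  have hc : φ / (4 * φ + 4) * 2 ≤ 1 := by
    rw [div_mul_eq_mul_div, div_le_one (by positivity)]
    linarith
  have := mul_le_mul_of_nonneg_left hcard (show 0 ≤ φ / (4 * φ + 4) by positivity)
  linarith

omit hbin hone huni hφ hreport hs in
/-- When nobody is left to choose, there is no potential. -/
lemma potential_of_not_interested (hp : ¬ I.PairPhase report h)
    (hi : ¬ (I.interested h).Nonempty) : I.potential O φ report h = 0 := by
  have : I.liveValues O h = ∅ := by
    by_contra hne
    obtain ⟨i, hmem⟩ := Finset.nonempty_iff_ne_empty.2 hne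
    simp only [liveValues, Finset.mem_filter, Finset.mem_univ, true_and] at hmem
    refine hi ⟨i, ?_⟩
    simp only [interested, Finset.mem_filter]
    exact ⟨hmem.1, O i, hmem.2.1, by rw [hmem.2.2]; exact one_pos⟩
  rw [I.potential_of_not_pairPhase O hp, this]
  simp

/-- The welfare expected after `h` is at least what has been created plus the potential. -/
lemma banked_add_potential_le [DecidableEq N] [DecidableEq V] {complete : History N V → (N ≃ V)}
    (hcomplete : IsCompletion complete) (k : ℕ) (h : History N V) (hm : IsPartialMatching h)
    (hk : (waiting h).card ≤ k) :
    I.banked h.toFinset + I.potential O φ report h ≤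
      I.expectedWelfare (I.run report s complete k h) := by
  have hfinal : ∀ h, IsPartialMatching h → ¬ I.PairPhase report h →
      ¬ (I.interested h).Nonempty → I.banked h.toFinset + I.potential O φ report h ≤
        I.expectedWelfare (PMF.pure (complete h)) := fun h hm hp hi => by
    rw [potential_of_not_interested O hp hi, add_zero, expectedWelfare_pure]
    exact I.banked_le_socialWelfare (hcomplete h hm)
  induction k generalizing h with
  | zero =>
    have hw : waiting h = ∅ := Finset.card_eq_zero.1 (Nat.le_zero.1 hk)
    refine hfinal h hm ?_ ?_
    · rintro ⟨⟨p, hp⟩, -⟩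
      have := ((mem_pairs I hreport).1 hp).2.1
      simp [hw] at this
    · rintro ⟨i, hi⟩
      simp [interested, hw] at hi
  | succ k ih =>
    rw [run]
    split_ifs with hp hi
    · refine I.le_expectedWelfare_uniform_bind hp.1 ?_
      change _ ≤ ∑ p ∈ _, I.expectedWelfare (I.run report s complete k (seatPair s h p))
      have hstep : ∀ p ∈ pairs report h,
          I.banked h.toFinset +
            (I.pairGain φ s h p + I.potential O φ report (seatPair s h p)) ≤
          I.expectedWelfare (I.run report s complete k (seatPair s h p)) := by
        intro p hpair
        obtain ⟨hadj, hi, hj⟩ := (mem_pairs I hreport).1 hpair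
        have hj' : p.2 ∈ waiting (h ++ [(p.1, s p.1 h)]) :=
          mem_waiting_append.2 ⟨hj, hadj.ne'⟩
        have hm1 := hm.append hi (hs.mem_free h p.1 hm hi)
        have hm2 := hm1.append hj' (hs.mem_free _ _ hm1 hj')
        have c1 := card_waiting_append (v := s p.1 h) hi
        have c2 := card_waiting_append (v := s p.2 (h ++ [(p.1, s p.1 h)])) hj'
        have := ih (seatPair s h p) hm2 (by unfold seatPair; omega)
        have := banked_seatPair (s := s) hreport huni hpair
        linarith
      -- Swapping is an involution of the drawn set, so the two-order inequality sums to twice the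
      -- one needed.
      have hswap : ∑ p ∈ pairs report h,
            (I.pairGain φ s h p.swap + I.potential O φ report (seatPair s h p.swap)) =
          ∑ p ∈ pairs report h,
            (I.pairGain φ s h p + I.potential O φ report (seatPair s h p)) :=
        Finset.sum_nbij' Prod.swap Prod.swap (fun p hq => (swap_mem_pairs I hreport).2 hq)
          (fun p hq => (swap_mem_pairs I hreport).2 hq) (fun p _ => p.swap_swap)
          (fun p _ => p.swap_swap) (fun p _ => rfl)
      have hsum := Finset.sum_le_sum fun p hq =>
        potential_add_potential_swap O hbin hone huni hφ hreport hs hm hp (p := p) hq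
      have hsteps := Finset.sum_le_sum hstep
      rw [Finset.sum_add_distrib, hswap, ← Finset.mul_sum] at hsum
      rw [Finset.sum_add_distrib] at hsteps ⊢
      linarith
    · refine I.le_expectedWelfare_uniform_bind hi (Finset.sum_le_sum fun i hmem => ?_)
      have hw : i ∈ waiting h := (Finset.mem_filter.1 hmem).1
      have c := card_waiting_append (v := s i h) hw
      have h1 := ih _ (hm.append hw (hs.mem_free h i hm hw)) (by omega)
      have h2 := banked_append (I := I) hw (s i h)
      have h3 := potential_le_of_interested O hbin hone huni hφ hreport hs hm hp hmem
      linarith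
    · exact hfinal h hm hp hi

omit hone hφ hs in
/-- At the start the potential covers the welfare of the reference allocation. -/
lemma socialWelfare_le_potential :
    φ / (4 * φ + 4) * I.socialWelfare O ≤ I.potential O φ report [] := by
  classical
  have h0 := huni.1
  have hv : ∑ i, I.value i (O i) = (I.liveValues O []).card := by
    rw [Finset.card_eq_sum_ones, Nat.cast_sum, liveValues, Finset.sum_filter]
    refine Finset.sum_congr rfl fun i _ => ?_
    rcases hbin i (O i) with e | e <;> simp [e, free, waiting]
  have he : ∑ i, ∑ j, (if I.friends.Adj i j ∧ I.plotGraph.Adj (O i) (O j) then I.weight i j else 0)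
      = φ * (I.liveEdges O []).card := by
    rw [Finset.card_eq_sum_ones, Nat.cast_sum, Finset.mul_sum, liveEdges, Finset.sum_filter,
      ← Finset.univ_product_univ, Finset.sum_product]
    refine Finset.sum_congr rfl fun i _ => Finset.sum_congr rfl fun j _ => ?_
    by_cases hij : I.friends.Adj i j
    · simp [hij, huni.2 _ _ hij, free]
    · simp [hij]
  -- Initially everyone waits, so every live edge is itself an available pair and the minimum loses
  -- nothing.
  have hmin : min (pairs report ([] : History N V)).card (I.liveEdges O []).card = (I.liveEdges O []).card := by
    refine min_eq_right (Finset.card_le_card fun p hp => ?_)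
    rw [mem_pairs I hreport]
    simp only [liveEdges, Finset.mem_filter] at hp
    exact ⟨hp.2.1, by simp [waiting], by simp [waiting]⟩
  unfold potential
  rw [hmin]
  refine mul_le_mul_of_nonneg_left (le_of_eq ?_) (by positivity)
  rw [← hv, ← he, ← Finset.sum_add_distrib]
  unfold socialWelfare utility
  refine Finset.sum_congr rfl fun i _ => ?_
  congr!

end Main

end LandInstance

theorem mainTheorem10 {N V : Type*} [Fintype N] [Fintype V] (I : LandInstance N V)
    (hbin : I.IsBinary) (hone : I.AtMostOneFriend)
    (φ : ℝ) (huni : I.FriendshipUniform φ) (hφ : φ < 1)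
    (report : N → Option N) (hreport : I.Truthful report)
    (s : Strategy N V) (hs : I.IsOptimal report s)
    (complete : History N V → (N ≃ V))
    (hcomplete : LandInstance.IsCompletion complete) :
    φ / (4 * φ + 4) * I.opt ≤ I.expectedWelfare (I.ffctrsd report s complete) := by
  classical
  obtain ⟨O, -, hO⟩ := Finset.exists_mem_eq_sup' (s := (Finset.univ : Finset (N ≃ V)))
    ⟨Fintype.equivOfCardEq I.card_eq, Finset.mem_univ _⟩ I.socialWelfare
  have hopt : I.opt = I.socialWelfare O := by
    rw [← hO]
    unfold LandInstance.opt
    congr!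
  have h1 := LandInstance.socialWelfare_le_potential O hbin huni hreport
  have h2 := LandInstance.banked_add_potential_le O hbin hone huni hφ hreport hs hcomplete
    (Fintype.card N) [] ⟨List.nodup_nil, List.nodup_nil⟩ (Finset.card_le_univ _)
  have h3 : I.banked ([] : History N V).toFinset = 0 := by simp [LandInstance.banked]
  rw [hopt]
  unfold LandInstance.ffctrsd
  linarith
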